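/- For $a,\alpha\in\mathbb{R}$ let $H^{a,\alpha}$ be the completion of the Schwartz space $\mathcal{S}(\mathbb{R}^{1+1})$ with respect to the norm $$\|u\|_{H^{a,\alpha}}=\bigl\|\langle\xi\rangle^{a}\,\langle|\tau|-|\xi|\rangle^{\alpha}\,\widetilde u(\tau,\xi)\bigr\|_{L^2_{\tau,\xi}(\mathbb{R}^2)},\qquad \langle s\rangle=1+|s|,\qquad \widetilde u(\tau,\xi)=\int_{\mathbb{R}^{1+1}}e^{-i(t\tau+x\xi)}u(t,x)\,dt\,dx .$$ Write $H^{a_1,\alpha_1}\cdot H^{a_2,\alpha_2}\hookrightarrow H^{a_3,\alpha_3}$ if there is a constant $C>0$ such that $\|uv\|_{H^{a_3,\alpha_3}}\le C\,\|u\|_{H^{a_1,\alpha_1}}\|v\|_{H^{a_2,\alpha_2}}$ for all $u\in H^{a_1,\alpha_1}$ and $v\in H^{a_2,\alpha_2}$, where $(u,v)\mapsto uv$ is bilinear and extends the pointwise product of Schwartz functions. Theorem. Let $a,b,c\in\mathbb{R}$, let $\alpha,\beta,\gamma\ge 0$, and suppose $\alpha+\beta+\gamma>\tfrac12$. Then $$H^{a,\alpha}\cdot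 H^{b,\beta}\hookrightarrow H^{-c,-\gamma}$$ holds provided that $$a+b+c>\tfrac12\qquad\text{and}\qquad a+b\ge 0,\quad a+c\ge 0,\quad b+c\ge 0 .$$ Conversely, if the embedding holds, then $a+b\ge0$, $a+c\ge0$, $b+c\ge0$ and $a+b+c\ge\tfrac12$. -/

import Mathlib

open MeasureTheory FourierTransform
open scoped SchwartzMap

namespace WaveSobolev

noncomputable section

/-- Space-time `ℝ^{1+1}`, with coordinates `(t, x) = (p 0, p 1)`; on the Fourier side the
coordinates are `(τ, ξ) = (q 0, q 1)`. -/
abbrev Spacetime : Type := EuclideanSpace ℝ (Fin 2)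

/-- The weight `⟨s⟩ = 1 + |s|`. -/
def angle (s : ℝ) : ℝ := 1 + |s|

/-- The space-time Fourier transform
`ũ(τ, ξ) = ∫ exp (-i (t τ + x ξ)) u(t, x) dt dx`. -/
def stFourier (u : Spacetime → ℂ) (q : Spacetime) : ℂ :=
  ∫ p : Spacetime, Complex.exp (-(Complex.I * ((p 0 * q 0 + p 1 * q 1 : ℝ) : ℂ))) * u p

/-- The wave-Sobolev weight `⟨ξ⟩^a ⟨|τ| - |ξ|⟩^α`. -/
def waveWeight (a α : ℝ) (q : Spacetime) : ℝ :=
  angle (q 1) ^ a * angle (|q 0| - |q 1|) ^ α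

/-- The weighted Fourier transform `⟨ξ⟩^a ⟨|τ| - |ξ|⟩^α ũ(τ, ξ)`. -/
def weightedFourier (a α : ℝ) (u : Spacetime → ℂ) (q : Spacetime) : ℂ :=
  (waveWeight a α q : ℂ) * stFourier u q

lemma angle_pos (s : ℝ) : 0 < angle s := by unfold angle; positivity

lemma waveWeight_pos (a α : ℝ) (q : Spacetime) : 0 < waveWeight a α q :=
  mul_pos (Real.rpow_pos_of_pos (angle_pos _) _) (Real.rpow_pos_of_pos (angle_pos _) _)

lemma continuous_waveWeight (a α : ℝ) : Continuous (waveWeight a α) := by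
  unfold waveWeight
  refine Continuous.mul (Continuous.rpow_const ?_ fun q => Or.inl (angle_pos _).ne')
    (Continuous.rpow_const ?_ fun q => Or.inl (angle_pos _).ne') <;>
  · unfold angle; fun_prop

/-- Dilation by `(2π)⁻¹`, relating `stFourier` to Mathlib's normalization of the Fourier
transform. -/
def dilation : Spacetime ≃L[ℝ] Spacetime :=
  ContinuousLinearEquiv.smulLeft (Units.mk0 ((2 * Real.pi)⁻¹ : ℝ) (by positivity))

lemma stFourier_eq (u : 𝓢(Spacetime, ℂ)) (q : Spacetime) :
    stFourier u q =
      SchwartzMap.compCLMOfContinuousLinearEquiv ℂ dilation (𝓕 u) q := by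
  have hd : dilation q = (2 * Real.pi)⁻¹ • q := rfl
  rw [SchwartzMap.compCLMOfContinuousLinearEquiv_apply, Function.comp_apply, hd,
    SchwartzMap.fourier_coe, Real.fourier_eq']
  unfold stFourier
  congr 1
  ext p
  rw [smul_eq_mul]
  congr 2
  simp only [inner_smul_right, PiLp.inner_apply, Fin.sum_univ_two, RCLike.inner_apply,
    conj_trivial]
  have : (Real.pi : ℂ) ≠ 0 := by exact_mod_cast Real.pi_ne_zero
  push_cast
  field_simp

lemma angle_rpow_le {s r : ℝ} (hs : |s| ≤ 1 + 2 * r ^ 2) (a : ℝ) :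
    angle s ^ a ≤ (2 * (1 + r ^ 2)) ^ ⌈|a|⌉₊ := by
  have h1 : 1 ≤ angle s := by unfold angle; linarith [abs_nonneg s]
  have h2 : angle s ≤ 2 * (1 + r ^ 2) := by unfold angle; linarith
  calc angle s ^ a ≤ angle s ^ (⌈|a|⌉₊ : ℝ) :=
        Real.rpow_le_rpow_of_exponent_le h1 ((le_abs_self a).trans (Nat.le_ceil _))
    _ = angle s ^ ⌈|a|⌉₊ := Real.rpow_natCast _ _
    _ ≤ _ := pow_le_pow_left₀ (angle_pos s).le h2 _

lemma exists_waveWeight_le (a α : ℝ) :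
    ∃ n : ℕ, ∀ q : Spacetime, waveWeight a α q ≤ (2 * (1 + ‖q‖ ^ 2)) ^ n := by
  refine ⟨⌈|a|⌉₊ + ⌈|α|⌉₊, fun q => ?_⟩
  have h0 : |q 0| ≤ ‖q‖ := PiLp.norm_apply_le q 0
  have h1 : |q 1| ≤ ‖q‖ := PiLp.norm_apply_le q 1
  have h3 : |(|q 0| - |q 1|)| ≤ ‖q‖ := by
    rw [abs_le]
    constructor <;> linarith [abs_nonneg (q 0), abs_nonneg (q 1)]
  have h4 : ‖q‖ ≤ 1 + 2 * ‖q‖ ^ 2 := by nlinarith [sq_nonneg (‖q‖ - 1), norm_nonneg q]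
  rw [pow_add]
  exact mul_le_mul (angle_rpow_le (h1.trans h4) a) (angle_rpow_le (h3.trans h4) α)
    (Real.rpow_nonneg (angle_pos _).le _) (by positivity)

lemma memLp_weightedFourier (a α : ℝ) (u : 𝓢(Spacetime, ℂ)) :
    MemLp (weightedFourier a α u) 2 (volume : Measure Spacetime) := by
  obtain ⟨n, hn⟩ := exists_waveWeight_le a α
  set f := SchwartzMap.compCLMOfContinuousLinearEquiv ℂ dilation (𝓕 u) with hf
  have hg0 : (fun q : Spacetime => 2 * (1 + ‖q‖ ^ 2)).HasTemperateGrowth :=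
    (Function.HasTemperateGrowth.const (2 : ℝ)).mul
      ((Function.HasTemperateGrowth.const (1 : ℝ)).add (Function.hasTemperateGrowth_norm_sq _))
  have hg : (fun q : Spacetime => (2 * (1 + ‖q‖ ^ 2)) ^ n).HasTemperateGrowth := hg0.pow n
  have heq : weightedFourier a α u = fun q => (waveWeight a α q : ℂ) * f q := by
    ext q; rw [weightedFourier, stFourier_eq]
  rw [heq]
  refine ((SchwartzMap.smulLeftCLM ℂ (fun q : Spacetime => (2 * (1 + ‖q‖ ^ 2)) ^ n) f).memLp
    2 volume).mono ?_ ?_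
  · exact ((Complex.continuous_ofReal.comp (continuous_waveWeight a α)).mul
      f.continuous).aestronglyMeasurable
  · refine Filter.Eventually.of_forall fun q => ?_
    rw [SchwartzMap.smulLeftCLM_apply_apply hg, norm_mul, norm_smul, Complex.norm_real,
      Real.norm_of_nonneg (waveWeight_pos a α q).le, Real.norm_of_nonneg (by positivity)]
    exact mul_le_mul_of_nonneg_right (hn q) (norm_nonneg _)

/-- The linear map `u ↦ ⟨ξ⟩^a ⟨|τ| - |ξ|⟩^α ũ(τ, ξ)` from Schwartz functions to `L²`. -/
def toL2 (a α : ℝ) : 𝓢(Spacetime, ℂ) →ₗ[ℂ] Lp ℂ 2 (volume : Measure Spacetime) where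
  toFun u := (memLp_weightedFourier a α u).toLp
  map_add' u v := by
    rw [← MemLp.toLp_add]
    refine MemLp.toLp_congr _ _ (Filter.Eventually.of_forall fun q => ?_)
    have h : stFourier (u + v : 𝓢(Spacetime, ℂ)) q = stFourier u q + stFourier v q := by
      simp only [stFourier_eq, FourierTransform.fourier_add, map_add]
      rfl
    rw [Pi.add_apply, weightedFourier, h, mul_add]
    rfl
  map_smul' c u := by
    rw [RingHom.id_apply, ← MemLp.toLp_const_smul]
    refine MemLp.toLp_congr _ _ (Filter.Eventually.of_forall fun q => ?_)
    have h : stFourier (c • u : 𝓢(Spacetime, ℂ)) q = c * stFourier u q := by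
      simp only [stFourier_eq, FourierTransform.fourier_smul, map_smul]
      rfl
    rw [Pi.smul_apply, weightedFourier, h, mul_left_comm]
    rfl

lemma toL2_injective (a α : ℝ) : Function.Injective (toL2 a α) := by
  rw [injective_iff_map_eq_zero]
  intro u hu
  have h0 : weightedFourier a α u =ᵐ[volume] 0 := by
    have h := (memLp_weightedFourier a α u).coeFn_toLp
    have h' : ((memLp_weightedFourier a α u).toLp : Lp ℂ 2 (volume : Measure Spacetime)) = 0 := hu
    rw [h'] at h
    exact h.symm.trans (Lp.coeFn_zero _ _ _)
  obtain ⟨f, hf⟩ : ∃ f, f = SchwartzMap.compCLMOfContinuousLinearEquiv ℂ dilation (𝓕 u) :=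
    ⟨_, rfl⟩
  have h1 : (f : Spacetime → ℂ) =ᵐ[volume] fun _ => 0 := by
    filter_upwards [h0] with q hq
    rw [weightedFourier, stFourier_eq, ← hf] at hq
    exact (mul_eq_zero.1 hq).resolve_left
      (Complex.ofReal_ne_zero.2 (waveWeight_pos a α q).ne')
  have h2 : (f : Spacetime → ℂ) = fun _ => 0 :=
    (Continuous.ae_eq_iff_eq volume f.continuous continuous_const).1 h1
  have h3 : 𝓕 u = 0 := by
    ext q
    have := congrFun h2 (dilation.symm q)
    rw [hf, SchwartzMap.compCLMOfContinuousLinearEquiv_apply, Function.comp_apply,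
      ContinuousLinearEquiv.apply_symm_apply] at this
    exact this
  rw [← FourierTransform.fourierInv_fourier_eq (F := 𝓢(Spacetime, ℂ)) u, h3,
    FourierTransform.fourierInv_zero]

/-- The Schwartz space `𝓢(ℝ^{1+1})`, to be equipped with the norm `‖·‖_{H^{a,α}}`. -/
def PreH (_a _α : ℝ) : Type := 𝓢(Spacetime, ℂ)

instance (a α : ℝ) : AddCommGroup (PreH a α) := inferInstanceAs (AddCommGroup 𝓢(Spacetime, ℂ))

instance (a α : ℝ) : Module ℂ (PreH a α) := inferInstanceAs (Module ℂ 𝓢(Spacetime, ℂ))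

/-- The identity map from the Schwartz space to `PreH a α`. -/
def toPreH (a α : ℝ) : 𝓢(Spacetime, ℂ) ≃ₗ[ℂ] PreH a α := LinearEquiv.refl ℂ 𝓢(Spacetime, ℂ)

/-- The norm `‖u‖_{H^{a,α}} = ‖⟨ξ⟩^a ⟨|τ| - |ξ|⟩^α ũ(τ, ξ)‖_{L²_{τ,ξ}}` on Schwartz functions. -/
instance (a α : ℝ) : NormedAddCommGroup (PreH a α) :=
  NormedAddCommGroup.induced (PreH a α) (Lp ℂ 2 (volume : Measure Spacetime))
    (toL2 a α ∘ₗ (toPreH a α).symm.toLinearMap)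
    ((toL2_injective a α).comp (toPreH a α).symm.injective)

instance (a α : ℝ) : NormedSpace ℂ (PreH a α) :=
  NormedSpace.induced ℂ (PreH a α) (Lp ℂ 2 (volume : Measure Spacetime))
    (toL2 a α ∘ₗ (toPreH a α).symm.toLinearMap)

lemma norm_toPreH (a α : ℝ) (u : 𝓢(Spacetime, ℂ)) :
    ‖toPreH a α u‖ = Real.sqrt (∫ q : Spacetime,
      (angle (q 1) ^ a * angle (|q 0| - |q 1|) ^ α * ‖stFourier u q‖) ^ 2) := by
  change ‖(memLp_weightedFourier a α u).toLp‖ = _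
  rw [Lp.norm_toLp, (memLp_weightedFourier a α u).eLpNorm_eq_integral_rpow_norm (by simp) (by simp),
    ENNReal.toReal_ofReal (by positivity), Real.sqrt_eq_rpow]
  norm_num
  congr 2
  ext q
  rw [weightedFourier, norm_mul, Complex.norm_real, Real.norm_of_nonneg (waveWeight_pos a α q).le]
  rfl

/-- The wave-Sobolev space `H^{a,α}`: the completion of `𝓢(ℝ^{1+1})` with respect to
`‖·‖_{H^{a,α}}`. -/
abbrev H (a α : ℝ) : Type := UniformSpace.Completion (PreH a α)

/-- A Schwartz function as an element of `H^{a,α}`. -/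
def ofSchwartz (a α : ℝ) (u : 𝓢(Spacetime, ℂ)) : H a α :=
  (toPreH a α u : UniformSpace.Completion (PreH a α))

/-- The pointwise product of two Schwartz functions. -/
def schwartzMul (u v : 𝓢(Spacetime, ℂ)) : 𝓢(Spacetime, ℂ) :=
  SchwartzMap.pairing (ContinuousLinearMap.mul ℂ ℂ) u v

lemma schwartzMul_apply (u v : 𝓢(Spacetime, ℂ)) (p : Spacetime) :
    schwartzMul u v p = u p * v p := rfl

/-- `H^{a₁,α₁} · H^{a₂,α₂} ↪ H^{a₃,α₃}`: the pointwise product of Schwartz functions extends to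
a bilinear product `(u, v) ↦ uv` from `H^{a₁,α₁} × H^{a₂,α₂}` to `H^{a₃,α₃}` with
`‖uv‖ ≤ C ‖u‖ ‖v‖`. -/
def ProductEmbeds (a₁ α₁ a₂ α₂ a₃ α₃ : ℝ) : Prop :=
  ∃ mul : H a₁ α₁ →ₗ[ℂ] H a₂ α₂ →ₗ[ℂ] H a₃ α₃,
    (∀ u v : 𝓢(Spacetime, ℂ),
      mul (ofSchwartz a₁ α₁ u) (ofSchwartz a₂ α₂ v) = ofSchwartz a₃ α₃ (schwartzMul u v)) ∧
    ∃ C : ℝ, 0 < C ∧ ∀ (u : H a₁ α₁) (v : H a₂ α₂), ‖mul u v‖ ≤ C * ‖u‖ * ‖v‖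

end

end WaveSobolev

/-!
On the Fourier side the product becomes a convolution, and by duality the embedding is a bound for
`∬ F(p) G(q - p) J(q) k(p, q)` by the `L²` norms of `F`, `G`, `J`, where `k` is the quotient of the
three weights.

**Sufficiency.** A product of nonpositive powers of numbers `≥ 1` is at most the full power of the
smallest of them. Hence the modulation part of `k` is at most the sum over the three points of
`⟨|τ| - |ξ|⟩ ^ (-(α + β + γ))`, and since `ξ₀ = ξ₁ + ξ₂`, the spatial part is at most a constant
times the sum of the `⟨ξ⟩ ^ (-(a + b + c))`; here a negative exponent among `a, b, c` is first
absorbed by the larger of the two other frequencies, which is where `a + b, a + c, b + c ≥ 0` enters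
(`exists_waveWeight_le_mul`). Both exponents exceed `1/2`, so the first weight is in `L²_τ`
uniformly in `ξ` and the second one in `L²_ξ`. On the line, a weight in `L²` on one of the three
factors gives a bounded trilinear form by two uses of Cauchy–Schwarz (`trilinear_sum_le`); using
this in `τ` for fixed spatial frequencies, and then in `ξ` for the `L²_τ` norms of the slices, gives
the planar estimate `trilinear_plane_le`. The resulting bound on Schwartz functions extends to the
completions by continuity (`productEmbeds_of_norm_le`).

**Necessity.** Take `u`, `v` with Fourier transforms `Φ(τ - ξ, ξ / L - k)` for one fixed compactly
supported `Φ`. All modulations are then bounded, and the transform of `u v` is `L` times a fixed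
profile in the chart with `k = k₁ + k₂`, so the estimate reads
`L ^ (1/2) ≲ K₁ ^ a K₂ ^ b K₀ ^ c`, the `K`s being the sizes of the frequencies
(`exists_sqrt_le_of_product_estimate`). Unit packets (`L = 1`) near `N, -N, 0` in the three possible
arrangements give the conditions on pairs, and `L = N` with all frequencies of size `N` gives
`a + b + c ≥ 1/2`.
-/

open scoped ENNReal

namespace WaveSobolev

noncomputable section

/-! ### Trilinear convolution estimates in `L²` -/


/-- The `L²` norm of a `[0, ∞]`-valued function. -/
def l2norm {X : Type*} [MeasureSpace X] (f : X → ℝ≥0∞) : ℝ≥0∞ :=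
  (∫⁻ x, f x ^ (2 : ℝ)) ^ (1 / 2 : ℝ)

lemma l2norm_rpow_two {X : Type*} [MeasureSpace X] (f : X → ℝ≥0∞) :
    l2norm f ^ (2 : ℝ) = ∫⁻ x, f x ^ (2 : ℝ) := by
  rw [l2norm, ← ENNReal.rpow_mul]; norm_num

lemma l2norm_mono {X : Type*} [MeasureSpace X] {f g : X → ℝ≥0∞} (h : ∀ x, f x ≤ g x) :
    l2norm f ≤ l2norm g :=
  ENNReal.rpow_le_rpow (lintegral_mono fun x => ENNReal.rpow_le_rpow (h x) (by norm_num))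
    (by norm_num)

lemma const_mul_l2norm {X : Type*} [MeasureSpace X] {c : ℝ≥0∞} (hc : c ≠ ∞) (f : X → ℝ≥0∞) :
    c * l2norm f = l2norm fun x => c * f x := by
  simp only [l2norm, ENNReal.mul_rpow_of_nonneg _ _ zero_le_two]
  rw [lintegral_const_mul' _ _ (ENNReal.rpow_ne_top_of_nonneg zero_le_two hc),
    ENNReal.mul_rpow_of_nonneg _ _ (by norm_num), ← ENNReal.rpow_mul]
  norm_num

lemma lintegral_mul_le_l2norm {X : Type*} [MeasureSpace X] {f g : X → ℝ≥0∞}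
    (hf : Measurable f) (hg : Measurable g) :
    ∫⁻ x, f x * g x ≤ l2norm f * l2norm g :=
  ENNReal.lintegral_mul_le_Lp_mul_Lq volume Real.HolderConjugate.two_two
    hf.aemeasurable hg.aemeasurable

lemma l2norm_sub_left (g : ℝ → ℝ≥0∞) (z : ℝ) : l2norm (fun x => g (z - x)) = l2norm g := by
  rw [l2norm, l2norm, lintegral_sub_left_eq_self (fun x => g x ^ (2 : ℝ)) z]

lemma l2norm_sub_right (g : ℝ → ℝ≥0∞) (z : ℝ) : l2norm (fun x => g (x - z)) = l2norm g := by
  rw [l2norm, l2norm, lintegral_sub_right_eq_self (fun x => g x ^ (2 : ℝ)) z]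

/-- A square-integrable weight on one factor makes that factor integrable, and the other two are
paired by Cauchy–Schwarz. -/
lemma trilinear_weight_left {f g h m : ℝ → ℝ≥0∞} (hf : Measurable f) (hg : Measurable g)
    (hh : Measurable h) (hm : Measurable m) :
    ∫⁻ z, ∫⁻ x, f x * g (z - x) * h z * m x ≤ l2norm m * (l2norm f * l2norm g * l2norm h) := by
  rw [lintegral_lintegral_swap (by fun_prop)]
  calc ∫⁻ x, ∫⁻ z, f x * g (z - x) * h z * m x
      = ∫⁻ x, (f x * m x) * ∫⁻ z, g (z - x) * h z := by
        refine lintegral_congr fun x => ?_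
        rw [← lintegral_const_mul _ (by fun_prop)]
        refine lintegral_congr fun z => ?_
        ring
    _ ≤ ∫⁻ x, (f x * m x) * (l2norm g * l2norm h) := by
        refine lintegral_mono fun x => ?_
        gcongr
        rw [← l2norm_sub_right g x]
        exact lintegral_mul_le_l2norm (by fun_prop) hh
    _ = (∫⁻ x, f x * m x) * (l2norm g * l2norm h) := lintegral_mul_const _ (by fun_prop)
    _ ≤ (l2norm f * l2norm m) * (l2norm g * l2norm h) := by
        gcongr
        exact lintegral_mul_le_l2norm hf hm
    _ = _ := by ring

lemma trilinear_weight_right {f g h m : ℝ → ℝ≥0∞} (hf : Measurable f) (hg : Measurable g)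
    (hh : Measurable h) (hm : Measurable m) :
    ∫⁻ z, ∫⁻ x, f x * g (z - x) * h z * m (z - x) ≤
      l2norm m * (l2norm f * l2norm g * l2norm h) := by
  calc ∫⁻ z, ∫⁻ x, f x * g (z - x) * h z * m (z - x)
      = ∫⁻ z, ∫⁻ x, g x * f (z - x) * h z * m x := by
        refine lintegral_congr fun z => ?_
        rw [← lintegral_sub_left_eq_self (fun x => f x * g (z - x) * h z * m (z - x)) z]
        refine lintegral_congr fun x => ?_
        rw [sub_sub_cancel]; ring
    _ ≤ l2norm m * (l2norm g * l2norm f * l2norm h) := trilinear_weight_left hg hf hh hm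
    _ = _ := by ring

lemma trilinear_weight_output {f g h m : ℝ → ℝ≥0∞} (hf : Measurable f) (hg : Measurable g)
    (hh : Measurable h) (hm : Measurable m) :
    ∫⁻ z, ∫⁻ x, f x * g (z - x) * h z * m z ≤ l2norm m * (l2norm f * l2norm g * l2norm h) := by
  calc ∫⁻ z, ∫⁻ x, f x * g (z - x) * h z * m z
      = ∫⁻ z, (h z * m z) * ∫⁻ x, f x * g (z - x) := by
        refine lintegral_congr fun z => ?_
        rw [← lintegral_const_mul _ (by fun_prop)]
        refine lintegral_congr fun x => ?_
        ring
    _ ≤ ∫⁻ z, (h z * m z) * (l2norm f * l2norm g) := by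
        refine lintegral_mono fun z => ?_
        gcongr
        rw [← l2norm_sub_left g z]
        exact lintegral_mul_le_l2norm hf (by fun_prop)
    _ = (∫⁻ z, h z * m z) * (l2norm f * l2norm g) := lintegral_mul_const _ (by fun_prop)
    _ ≤ (l2norm h * l2norm m) * (l2norm f * l2norm g) := by
        gcongr
        exact lintegral_mul_le_l2norm hh hm
    _ = _ := by ring

lemma trilinear_sum_le {f g h m₁ m₂ m₀ : ℝ → ℝ≥0∞} {M : ℝ≥0∞} (hf : Measurable f)
    (hg : Measurable g) (hh : Measurable h) (h₁ : Measurable m₁) (h₂ : Measurable m₂)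
    (h₀ : Measurable m₀) (hM₁ : l2norm m₁ ≤ M) (hM₂ : l2norm m₂ ≤ M) (hM₀ : l2norm m₀ ≤ M) :
    ∫⁻ z, ∫⁻ x, f x * g (z - x) * h z * (m₁ x + m₂ (z - x) + m₀ z) ≤
      3 * M * (l2norm f * l2norm g * l2norm h) := by
  simp only [mul_add]
  have e1 : ∀ z, ∫⁻ x, (f x * g (z - x) * h z * m₁ x + f x * g (z - x) * h z * m₂ (z - x) +
      f x * g (z - x) * h z * m₀ z) = (∫⁻ x, f x * g (z - x) * h z * m₁ x) +
      (∫⁻ x, f x * g (z - x) * h z * m₂ (z - x)) + ∫⁻ x, f x * g (z - x) * h z * m₀ z := by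
    intro z
    rw [lintegral_add_left (by fun_prop), lintegral_add_left (by fun_prop)]
  simp only [e1]
  rw [lintegral_add_left, lintegral_add_left]
  · calc _ ≤ M * (l2norm f * l2norm g * l2norm h) + M * (l2norm f * l2norm g * l2norm h) +
          M * (l2norm f * l2norm g * l2norm h) := by
          gcongr
          · exact (trilinear_weight_left hf hg hh h₁).trans (by gcongr)
          · exact (trilinear_weight_right hf hg hh h₂).trans (by gcongr)
          · exact (trilinear_weight_output hf hg hh h₀).trans (by gcongr)
      _ = _ := by ring
  · exact Measurable.lintegral_prod_right (by fun_prop)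
  · exact (Measurable.lintegral_prod_right (by fun_prop)).add
      (Measurable.lintegral_prod_right (by fun_prop))

lemma measurable_l2norm_slice {F : ℝ × ℝ → ℝ≥0∞} (hF : Measurable F) :
    Measurable fun ξ => l2norm fun τ => F (τ, ξ) := by
  unfold l2norm
  exact (Measurable.lintegral_prod_left (hF.pow_const _)).pow_const _

lemma l2norm_l2norm_slice {F : ℝ × ℝ → ℝ≥0∞} (hF : Measurable F) :
    l2norm (fun ξ => l2norm fun τ => F (τ, ξ)) = l2norm F := by
  conv_lhs => rw [l2norm]
  simp only [l2norm_rpow_two]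
  rw [l2norm, Measure.volume_eq_prod, lintegral_prod_symm' _ (hF.pow_const _)]

/-- The estimate in the plane: the weight in `τ` is handled by `trilinear_sum_le` for fixed
`ξ`-frequencies, uniformly, and the weight in `ξ` by `trilinear_sum_le` applied to the
`L²_τ` norms of the slices. -/
lemma trilinear_plane_le {F G J w : ℝ × ℝ → ℝ≥0∞} {m : ℝ → ℝ≥0∞} {M₁ M₂ : ℝ≥0∞}
    (hF : Measurable F) (hG : Measurable G) (hJ : Measurable J) (hw : Measurable w)
    (hm : Measurable m) (hM₁ : ∀ ξ, l2norm (fun τ => w (τ, ξ)) ≤ M₁) (hM₂ : l2norm m ≤ M₂) :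
    ∫⁻ q : ℝ × ℝ, ∫⁻ p : ℝ × ℝ, F p * G (q - p) * J q *
      ((w p + w (q - p) + w q) * (m p.2 + m (q.2 - p.2) + m q.2)) ≤
      3 * M₁ * (3 * M₂) * (l2norm F * l2norm G * l2norm J) := by
  rw [Measure.volume_eq_prod, lintegral_prod_symm']
  swap
  · exact Measurable.lintegral_prod_right (by fun_prop)
  have e : ∀ ζ z : ℝ, ∫⁻ p : ℝ × ℝ, F p * G ((z, ζ) - p) * J (z, ζ) *
      ((w p + w ((z, ζ) - p) + w (z, ζ)) * (m p.2 + m (ζ - p.2) + m ζ))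
      ∂((volume : Measure ℝ).prod volume) = ∫⁻ ξ, ∫⁻ x, F (x, ξ) * G (z - x, ζ - ξ) * J (z, ζ) *
      ((w (x, ξ) + w (z - x, ζ - ξ) + w (z, ζ)) * (m ξ + m (ζ - ξ) + m ζ)) := by
    intro ζ z
    rw [lintegral_prod_symm' _ (by fun_prop)]
    rfl
  simp only [e]
  calc _ = ∫⁻ ζ, ∫⁻ ξ, ∫⁻ z, ∫⁻ x, F (x, ξ) * G (z - x, ζ - ξ) * J (z, ζ) *
      ((w (x, ξ) + w (z - x, ζ - ξ) + w (z, ζ)) * (m ξ + m (ζ - ξ) + m ζ)) := by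
        refine lintegral_congr fun ζ => ?_
        rw [lintegral_lintegral_swap]
        exact (Measurable.lintegral_prod_right (by fun_prop)).aemeasurable
    _ ≤ ∫⁻ ζ, ∫⁻ ξ, 3 * M₁ * (l2norm (fun τ => F (τ, ξ)) * l2norm (fun τ => G (τ, ζ - ξ)) *
          l2norm (fun τ => J (τ, ζ)) * (m ξ + m (ζ - ξ) + m ζ)) := by
        refine lintegral_mono fun ζ => lintegral_mono fun ξ => ?_
        simp only [← mul_assoc]
        have : ∀ z, ∫⁻ x, F (x, ξ) * G (z - x, ζ - ξ) * J (z, ζ) *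
            (w (x, ξ) + w (z - x, ζ - ξ) + w (z, ζ)) * (m ξ + m (ζ - ξ) + m ζ) =
            (∫⁻ x, F (x, ξ) * G (z - x, ζ - ξ) * J (z, ζ) *
              (w (x, ξ) + w (z - x, ζ - ξ) + w (z, ζ))) * (m ξ + m (ζ - ξ) + m ζ) :=
          fun z => lintegral_mul_const _ (by fun_prop)
        simp only [this]
        rw [lintegral_mul_const _ (Measurable.lintegral_prod_right (by fun_prop))]
        gcongr
        refine (trilinear_sum_le (f := fun τ => F (τ, ξ)) (g := fun τ => G (τ, ζ - ξ))
          (h := fun τ => J (τ, ζ)) (m₁ := fun τ => w (τ, ξ)) (m₂ := fun τ => w (τ, ζ - ξ))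
          (m₀ := fun τ => w (τ, ζ)) (by fun_prop) (by fun_prop) (by fun_prop) (by fun_prop)
          (by fun_prop) (by fun_prop) (hM₁ _) (hM₁ _) (hM₁ _)).trans_eq (by ring)
    _ = 3 * M₁ * ∫⁻ ζ, ∫⁻ ξ, (l2norm (fun τ => F (τ, ξ)) * l2norm (fun τ => G (τ, ζ - ξ)) *
          l2norm (fun τ => J (τ, ζ)) * (m ξ + m (ζ - ξ) + m ζ)) := by
        have hF' := measurable_l2norm_slice hF
        have hG' := measurable_l2norm_slice hG
        have hJ' := measurable_l2norm_slice hJ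
        have hG'' : Measurable fun p : ℝ × ℝ => l2norm (fun τ => G (τ, p.1 - p.2)) :=
          hG'.comp (measurable_fst.sub measurable_snd)
        have hG3 (ζ : ℝ) : Measurable fun ξ : ℝ => l2norm (fun τ => G (τ, ζ - ξ)) :=
          hG'.comp (measurable_const.sub measurable_id)
        rw [← lintegral_const_mul _ (Measurable.lintegral_prod_right
          (((((hF'.comp measurable_snd).mul hG'').mul (hJ'.comp measurable_fst))).mul
            (by fun_prop : Measurable fun p : ℝ × ℝ => m p.2 + m (p.1 - p.2) + m p.1)))]
        refine lintegral_congr fun ζ => ?_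
        rw [← lintegral_const_mul _ (by have := hG3 ζ; fun_prop)]
    _ ≤ 3 * M₁ * (3 * M₂ * (l2norm F * l2norm G * l2norm J)) := by
        gcongr
        rw [← l2norm_l2norm_slice hF, ← l2norm_l2norm_slice hG, ← l2norm_l2norm_slice hJ]
        exact trilinear_sum_le (measurable_l2norm_slice hF) (measurable_l2norm_slice hG)
          (measurable_l2norm_slice hJ) hm hm hm hM₂ hM₂ hM₂
    _ = _ := by ring

/-! ### Pointwise bounds for the weights -/

lemma one_le_angle (s : ℝ) : 1 ≤ angle s := by unfold angle; linarith [abs_nonneg s]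

lemma continuous_angle_rpow (r : ℝ) : Continuous fun s => angle s ^ r :=
  Continuous.rpow_const (by unfold angle; fun_prop) fun s => Or.inl (angle_pos s).ne'

/-- A product of negative powers is at most the power of the smallest base. -/
lemma rpow_neg_mul_le_sum {A B C a b c : ℝ} (hA : 1 ≤ A) (hB : 1 ≤ B) (hC : 1 ≤ C)
    (ha : 0 ≤ a) (hb : 0 ≤ b) (hc : 0 ≤ c) :
    A ^ (-a) * B ^ (-b) * C ^ (-c) ≤
      A ^ (-(a + b + c)) + B ^ (-(a + b + c)) + C ^ (-(a + b + c)) := by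
  have key : ∀ m : ℝ, 1 ≤ m → m ≤ A → m ≤ B → m ≤ C →
      A ^ (-a) * B ^ (-b) * C ^ (-c) ≤ m ^ (-(a + b + c)) := by
    intro m h1 h2 h3 h4
    have hm : 0 < m := by linarith
    have : m ^ (-(a + b + c)) = m ^ (-a) * m ^ (-b) * m ^ (-c) := by
      rw [← Real.rpow_add hm, ← Real.rpow_add hm]; congr 1; ring
    rw [this]
    gcongr ?_ * ?_ * ?_
    · exact Real.rpow_le_rpow_of_nonpos hm h2 (by linarith)
    · exact Real.rpow_le_rpow_of_nonpos hm h3 (by linarith)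
    · exact Real.rpow_le_rpow_of_nonpos hm h4 (by linarith)
  have pA : 0 ≤ A ^ (-(a + b + c)) := by positivity
  have pB : 0 ≤ B ^ (-(a + b + c)) := by positivity
  have pC : 0 ≤ C ^ (-(a + b + c)) := by positivity
  rcases le_total A B with hAB | hAB
  · rcases le_total A C with hAC | hAC
    · linarith [key A hA le_rfl hAB hAC]
    · linarith [key C hC hAC (hAC.trans hAB) le_rfl]
  · rcases le_total B C with hBC | hBC
    · linarith [key B hB hAB le_rfl hBC]
    · linarith [key C hC (hBC.trans hAB) hBC le_rfl]

/-- The case of one negative exponent: its base is controlled by the larger of the other two, so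
that the negative exponent is absorbed by that one. -/
lemma rpow_neg_mul_le_sum_of_nonpos {A B C a b c : ℝ} (hA : 1 ≤ A) (hB : 1 ≤ B) (hC : 1 ≤ C)
    (hABC : C ≤ A + B) (hac : 0 ≤ a + c) (hbc : 0 ≤ b + c) (hc : c ≤ 0) :
    A ^ (-a) * B ^ (-b) * C ^ (-c) ≤
      2 ^ (-c) * (A ^ (-(a + b + c)) + B ^ (-(a + b + c)) + C ^ (-(a + b + c))) := by
  have hA0 : 0 < A := by linarith
  have hB0 : 0 < B := by linarith
  rcases le_total B A with h | h
  · have h1 : C ^ (-c) ≤ 2 ^ (-c) * A ^ (-c) := by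
      rw [← Real.mul_rpow (by norm_num) hA0.le]
      exact Real.rpow_le_rpow (by linarith) (by linarith) (by linarith)
    have h2 := rpow_neg_mul_le_sum hA hB hC hac (by linarith : 0 ≤ b) le_rfl
    rw [show a + c + b + 0 = a + b + c by ring, neg_zero, Real.rpow_zero, mul_one] at h2
    calc A ^ (-a) * B ^ (-b) * C ^ (-c) ≤ A ^ (-a) * B ^ (-b) * (2 ^ (-c) * A ^ (-c)) := by gcongr
      _ = 2 ^ (-c) * (A ^ (-(a + c)) * B ^ (-b)) := by
        rw [show -(a + c) = -a + -c by ring, Real.rpow_add hA0]; ring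
      _ ≤ _ := by gcongr
  · have h1 : C ^ (-c) ≤ 2 ^ (-c) * B ^ (-c) := by
      rw [← Real.mul_rpow (by norm_num) hB0.le]
      exact Real.rpow_le_rpow (by linarith) (by linarith) (by linarith)
    have h2 := rpow_neg_mul_le_sum hA hB hC (by linarith : 0 ≤ a) hbc le_rfl
    rw [show a + (b + c) + 0 = a + b + c by ring, neg_zero, Real.rpow_zero, mul_one] at h2
    calc A ^ (-a) * B ^ (-b) * C ^ (-c) ≤ A ^ (-a) * B ^ (-b) * (2 ^ (-c) * B ^ (-c)) := by gcongr
      _ = 2 ^ (-c) * (A ^ (-a) * B ^ (-(b + c))) := by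
        rw [show -(b + c) = -b + -c by ring, Real.rpow_add hB0]; ring
      _ ≤ _ := by gcongr

lemma exists_rpow_neg_mul_le_sum {a b c : ℝ} (hab : 0 ≤ a + b) (hac : 0 ≤ a + c)
    (hbc : 0 ≤ b + c) : ∃ K : ℝ, 0 < K ∧ ∀ A B C : ℝ, 1 ≤ A → 1 ≤ B → 1 ≤ C →
      A ≤ B + C → B ≤ A + C → C ≤ A + B → A ^ (-a) * B ^ (-b) * C ^ (-c) ≤
        K * (A ^ (-(a + b + c)) + B ^ (-(a + b + c)) + C ^ (-(a + b + c))) := by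
  rcases le_total c 0 with hc | hc
  · exact ⟨2 ^ (-c), by positivity, fun A B C hA hB hC _ _ h =>
      rpow_neg_mul_le_sum_of_nonpos hA hB hC h hac hbc hc⟩
  rcases le_total a 0 with ha | ha
  · refine ⟨2 ^ (-a), by positivity, fun A B C hA hB hC h _ _ => ?_⟩
    have := rpow_neg_mul_le_sum_of_nonpos hB hC hA h
      (by linarith : 0 ≤ b + a) (by linarith : 0 ≤ c + a) ha
    rw [show b + c + a = a + b + c by ring] at this
    linarith
  rcases le_total b 0 with hb | hb
  · refine ⟨2 ^ (-b), by positivity, fun A B C hA hB hC _ h _ => ?_⟩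
    have := rpow_neg_mul_le_sum_of_nonpos hA hC hB h hab
      (by linarith : 0 ≤ c + b) hb
    rw [show a + c + b = a + b + c by ring] at this
    linarith
  · refine ⟨1, one_pos, fun A B C hA hB hC _ _ _ => ?_⟩
    rw [one_mul]
    exact rpow_neg_mul_le_sum hA hB hC ha hb hc

lemma angle_add_le (x y : ℝ) : angle (x + y) ≤ angle x + angle y := by
  unfold angle; linarith [abs_add_le x y]

/-- The multiplier bound: the ratio of the weights is dominated by products of one power
`⟨ξ_i⟩^{-(a+b+c)}` and one power `⟨|τ_j| - |ξ_j|⟩^{-(α+β+γ)}`. -/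
lemma exists_waveWeight_le_mul {a b c α β γ : ℝ} (hab : 0 ≤ a + b) (hac : 0 ≤ a + c)
    (hbc : 0 ≤ b + c) (hα : 0 ≤ α) (hβ : 0 ≤ β) (hγ : 0 ≤ γ) :
    ∃ K : ℝ, 0 < K ∧ ∀ ξ η ζ X Y Z : ℝ, ζ = ξ + η →
      angle ζ ^ (-c) * angle Z ^ (-γ) ≤ K * (angle ξ ^ a * angle X ^ α) *
        (angle η ^ b * angle Y ^ β) *
        ((angle X ^ (-(α + β + γ)) + angle Y ^ (-(α + β + γ)) + angle Z ^ (-(α + β + γ))) *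
        (angle ξ ^ (-(a + b + c)) + angle η ^ (-(a + b + c)) + angle ζ ^ (-(a + b + c)))) := by
  obtain ⟨K, hK, h⟩ := exists_rpow_neg_mul_le_sum hab hac hbc
  refine ⟨K, hK, fun ξ η ζ X Y Z hζ => ?_⟩
  have h1 := h (angle ξ) (angle η) (angle ζ) (one_le_angle _) (one_le_angle _) (one_le_angle _)
    (by
      have := angle_add_le ζ (-η)
      rw [hζ, add_neg_cancel_right] at this
      simp only [angle, abs_neg] at this ⊢
      rw [hζ]; linarith)
    (by
      have := angle_add_le ζ (-ξ)
      rw [hζ, add_neg_cancel_comm] at this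
      simp only [angle, abs_neg] at this ⊢
      rw [hζ]; linarith)
    (by rw [hζ]; exact angle_add_le _ _)
  have h2 := rpow_neg_mul_le_sum (one_le_angle X) (one_le_angle Y) (one_le_angle Z) hα hβ hγ
  have cancel : ∀ s r : ℝ, angle s ^ (-r) * angle s ^ r = 1 := fun s r => by
    rw [← Real.rpow_add (angle_pos s), neg_add_cancel, Real.rpow_zero]
  have p : ∀ s r : ℝ, 0 < angle s ^ r := fun s r => Real.rpow_pos_of_pos (angle_pos s) r
  have h3 := mul_le_mul h2 h1 (mul_nonneg (mul_nonneg (p _ _).le (p _ _).le) (p _ _).le)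
    (add_nonneg (add_nonneg (p _ _).le (p _ _).le) (p _ _).le)
  calc angle ζ ^ (-c) * angle Z ^ (-γ)
      = ((angle ξ ^ a * angle X ^ α) * (angle η ^ b * angle Y ^ β)) *
        (angle X ^ (-α) * angle Y ^ (-β) * angle Z ^ (-γ) *
          (angle ξ ^ (-a) * angle η ^ (-b) * angle ζ ^ (-c))) := by
        linear_combination (-(angle ζ ^ (-c) * angle Z ^ (-γ))) * (cancel ξ a +
          (angle ξ ^ (-a) * angle ξ ^ a) * (cancel η b + (angle η ^ (-b) * angle η ^ b) *
          (cancel X α + (angle X ^ (-α) * angle X ^ α) * cancel Y β)))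
    _ ≤ ((angle ξ ^ a * angle X ^ α) * (angle η ^ b * angle Y ^ β)) * _ :=
        mul_le_mul_of_nonneg_left h3
          (mul_pos (mul_pos (p _ _) (p _ _)) (mul_pos (p _ _) (p _ _))).le
    _ = _ := by ring

/-! ### Square integrability of the weights -/

lemma lintegral_angle_rpow_lt_top {s : ℝ} (hs : 1 / 2 < s) :
    ∫⁻ x, ENNReal.ofReal (angle x ^ (-s)) ^ (2 : ℝ) < ∞ := by
  have h := (integrable_one_add_norm (E := ℝ) (μ := volume) (r := 2 * s)
    (by simp; linarith)).lintegral_lt_top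
  convert h using 3 with x
  rw [ENNReal.ofReal_rpow_of_nonneg (Real.rpow_nonneg (angle_pos x).le _) (by norm_num),
    ← Real.rpow_mul (angle_pos x).le]
  congr 2
  ring

lemma l2norm_angle_lt_top {s : ℝ} (hs : 1 / 2 < s) :
    l2norm (fun x => ENNReal.ofReal (angle x ^ (-s))) < ∞ :=
  ENNReal.rpow_lt_top_of_nonneg (by norm_num) (lintegral_angle_rpow_lt_top hs).ne

/-- The modulation weight is square-integrable in `τ`, uniformly in `ξ`, since
`||τ| - |ξ||` is the smaller of `|τ - ξ|` and `|τ + ξ|`. -/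
lemma exists_l2norm_modulation_le {s : ℝ} (hs : 1 / 2 < s) : ∃ M : ℝ≥0∞, M < ∞ ∧ ∀ ξ : ℝ,
    l2norm (fun τ => ENNReal.ofReal (angle (|τ| - |ξ|) ^ (-s))) ≤ M := by
  set g : ℝ → ℝ≥0∞ := fun x => ENNReal.ofReal (angle x ^ (-s)) ^ (2 : ℝ) with hg
  have hgm : Measurable g := ((continuous_angle_rpow _).measurable.ennreal_ofReal).pow_const _
  have hlt := lintegral_angle_rpow_lt_top hs
  refine ⟨(∫⁻ x, g x + g x) ^ (1 / 2 : ℝ), ENNReal.rpow_lt_top_of_nonneg (by norm_num) ?_,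
    fun ξ => ?_⟩
  · rw [lintegral_add_left hgm]
    exact (ENNReal.add_lt_top.2 ⟨hlt, hlt⟩).ne
  · refine ENNReal.rpow_le_rpow ?_ (by norm_num)
    calc ∫⁻ τ, ENNReal.ofReal (angle (|τ| - |ξ|) ^ (-s)) ^ (2 : ℝ)
        ≤ ∫⁻ τ, g (τ - ξ) + g (τ + ξ) := by
          refine lintegral_mono fun τ => ?_
          have : angle (|τ| - |ξ|) = angle (τ - ξ) ∨ angle (|τ| - |ξ|) = angle (τ + ξ) := by
            unfold angle
            rcases abs_cases τ with ⟨h1, _⟩ | ⟨h1, _⟩ <;> rcases abs_cases ξ with ⟨h2, _⟩ | ⟨h2, _⟩ <;>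
              rw [h1, h2]
            · left; rfl
            · right; rw [sub_neg_eq_add]
            · right; rw [← abs_neg (-τ - ξ)]; congr 2; ring
            · left; rw [← abs_neg (-τ - -ξ)]; congr 2; ring
          rcases this with h | h <;> simp only [hg, h]
          · exact le_self_add
          · exact le_add_self
      _ = ∫⁻ x, g x + g x := by
          rw [lintegral_add_left (by fun_prop), lintegral_add_left hgm,
            lintegral_sub_right_eq_self g, lintegral_add_right_eq_self g]

/-! ### The space-time Fourier transform on Schwartz functions -/

/-- The space-time Fourier transform as a Schwartz function. -/
def stFourierSchwartz (u : 𝓢(Spacetime, ℂ)) : 𝓢(Spacetime, ℂ) :=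
  SchwartzMap.compCLMOfContinuousLinearEquiv ℂ dilation (𝓕 u)

lemma stFourierSchwartz_apply (u : 𝓢(Spacetime, ℂ)) (q : Spacetime) :
    stFourierSchwartz u q = stFourier u q := (stFourier_eq u q).symm

lemma continuous_stFourier (u : 𝓢(Spacetime, ℂ)) : Continuous (stFourier u) :=
  (stFourierSchwartz u).continuous.congr (stFourierSchwartz_apply u)

lemma exists_stFourier_eq (f : 𝓢(Spacetime, ℂ)) :
    ∃ u : 𝓢(Spacetime, ℂ), ∀ q, stFourier u q = f q := by
  refine ⟨𝓕⁻ (SchwartzMap.compCLMOfContinuousLinearEquiv ℂ dilation.symm f), fun q => ?_⟩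
  rw [stFourier_eq, FourierTransform.fourier_fourierInv_eq]
  simp [SchwartzMap.compCLMOfContinuousLinearEquiv_apply]

lemma fourier_schwartzMul (u v : 𝓢(Spacetime, ℂ)) (q : Spacetime) :
    𝓕 (schwartzMul u v) q = ∫ p, 𝓕 u p * 𝓕 v (q - p) := by
  have hneg : ∀ (f : 𝓢(Spacetime, ℂ)) (x : Spacetime), 𝓕⁻ f (-x) = 𝓕 f x := fun f x => by
    rw [SchwartzMap.fourierInv_coe, SchwartzMap.fourier_coe, Real.fourierInv_eq_fourier_neg,
      neg_neg]
  have h := SchwartzMap.convolution_apply (ContinuousLinearMap.mul ℂ ℂ) (𝓕⁻ u) (𝓕⁻ v) (-q)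
  have h' : SchwartzMap.convolution (ContinuousLinearMap.mul ℂ ℂ) (𝓕⁻ u) (𝓕⁻ v) =
      𝓕⁻ (schwartzMul u v) := by
    change 𝓕⁻ (SchwartzMap.pairing (ContinuousLinearMap.mul ℂ ℂ) (𝓕 (𝓕⁻ u)) (𝓕 (𝓕⁻ v))) = _
    rw [FourierTransform.fourier_fourierInv_eq, FourierTransform.fourier_fourierInv_eq]
    rfl
  rw [h', hneg] at h
  rw [h, convolution_def, ← integral_neg_eq_self]
  refine integral_congr_ae (Filter.Eventually.of_forall fun p => ?_)
  change 𝓕⁻ u (-p) * 𝓕⁻ v (-q - -p) = _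
  rw [hneg, show -q - -p = -(q - p) by abel, hneg]

/-- The transform of a product is the convolution of the transforms, with the factor
`(2π)⁻²` of the unnormalized convention. -/
lemma stFourier_schwartzMul (u v : 𝓢(Spacetime, ℂ)) (q : Spacetime) :
    stFourier (schwartzMul u v) q =
      ((2 * (Real.pi : ℂ)) ^ 2)⁻¹ * ∫ p, stFourier u p * stFourier v (q - p) := by
  have hd : ∀ x : Spacetime, dilation x = (2 * Real.pi)⁻¹ • x := fun _ => rfl
  have e : ∀ (w : 𝓢(Spacetime, ℂ)) x, stFourier w x = 𝓕 w ((2 * Real.pi)⁻¹ • x) := fun w x => by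
    rw [stFourier_eq, SchwartzMap.compCLMOfContinuousLinearEquiv_apply, Function.comp_apply, hd]
  simp only [e]
  rw [fourier_schwartzMul]
  simp only [smul_sub]
  have := Measure.integral_comp_smul (volume : Measure Spacetime)
    (fun p => 𝓕 u p * 𝓕 v ((2 * Real.pi)⁻¹ • q - p)) (2 * Real.pi)⁻¹
  rw [this, finrank_euclideanSpace_fin, abs_of_pos (by positivity), inv_pow, inv_inv,
    Complex.real_smul, ← mul_assoc]
  have : ((2 * Real.pi : ℝ) : ℂ) ≠ 0 := by exact_mod_cast (by positivity : 2 * Real.pi ≠ 0)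
  push_cast at this ⊢
  rw [inv_mul_cancel₀ (pow_ne_zero 2 this), one_mul]

lemma ofReal_norm_toPreH (a α : ℝ) (u : 𝓢(Spacetime, ℂ)) :
    ENNReal.ofReal ‖toPreH a α u‖ =
      l2norm fun q => ENNReal.ofReal (waveWeight a α q) * ‖stFourier u q‖ₑ := by
  change ENNReal.ofReal ‖(memLp_weightedFourier a α u).toLp‖ = _
  rw [Lp.norm_toLp, ENNReal.ofReal_toReal (memLp_weightedFourier a α u).2.ne,
    eLpNorm_eq_lintegral_rpow_enorm_toReal (by simp) (by simp), l2norm]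
  simp only [ENNReal.toReal_ofNat]
  congr 2
  ext q
  rw [weightedFourier, enorm_mul, ← ofReal_norm (waveWeight a α q : ℂ),
    Complex.norm_real, Real.norm_of_nonneg (waveWeight_pos a α q).le]

lemma measurable_ofReal_waveWeight (a α : ℝ) :
    Measurable fun q => ENNReal.ofReal (waveWeight a α q) :=
  (continuous_waveWeight a α).measurable.ennreal_ofReal

/-- The point of space-time with given coordinates. -/
def ofPlane (p : ℝ × ℝ) : Spacetime := WithLp.toLp 2 ![p.1, p.2]

lemma ofPlane_sub (p q : ℝ × ℝ) : ofPlane (p - q) = ofPlane p - ofPlane q := by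
  ext i; fin_cases i <;> simp [ofPlane]

lemma measurePreserving_ofPlane : MeasurePreserving ofPlane volume volume :=
  (PiLp.volume_preserving_toLp (Fin 2)).comp (volume_preserving_finTwoArrow ℝ).symm

lemma l2norm_comp_ofPlane {f : Spacetime → ℝ≥0∞} (hf : Measurable f) :
    l2norm (fun p => f (ofPlane p)) = l2norm f := by
  rw [l2norm, l2norm, ← measurePreserving_ofPlane.lintegral_comp (hf.pow_const _)]

/-! ### Sufficiency -/

/-- Duality: it suffices to test `h` against itself. -/
lemma l2norm_le_of_lintegral_le {X : Type*} [MeasureSpace X] {h : X → ℝ≥0∞} {c : ℝ≥0∞}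
    (hfin : l2norm h ≠ ∞) (hc : ∫⁻ x, h x * h x ≤ c * l2norm h) : l2norm h ≤ c := by
  rcases eq_or_ne (l2norm h) 0 with h0 | h0
  · rw [h0]; exact zero_le
  · have : ∫⁻ x, h x * h x = l2norm h * l2norm h := by
      have h2 := l2norm_rpow_two h
      simp only [ENNReal.rpow_two, pow_two] at h2
      exact h2.symm
    rw [this] at hc
    exact (ENNReal.mul_le_mul_iff_left h0 hfin).1 hc

lemma exists_norm_schwartzMul_le {a b c α β γ : ℝ} (hα : 0 ≤ α) (hβ : 0 ≤ β) (hγ : 0 ≤ γ)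
    (hαβγ : 1 / 2 < α + β + γ) (habc : 1 / 2 < a + b + c) (hab : 0 ≤ a + b) (hac : 0 ≤ a + c)
    (hbc : 0 ≤ b + c) : ∃ C : ℝ, 0 ≤ C ∧ ∀ u v : 𝓢(Spacetime, ℂ),
      ‖toPreH (-c) (-γ) (schwartzMul u v)‖ ≤ C * ‖toPreH a α u‖ * ‖toPreH b β v‖ := by
  obtain ⟨K, hK, hpt⟩ := exists_waveWeight_le_mul hab hac hbc hα hβ hγ
  obtain ⟨M₁, hM₁, hM₁'⟩ := exists_l2norm_modulation_le hαβγ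
  set w : ℝ × ℝ → ℝ≥0∞ := fun p => ENNReal.ofReal (angle (|p.1| - |p.2|) ^ (-(α + β + γ))) with hw
  set m : ℝ → ℝ≥0∞ := fun ξ => ENNReal.ofReal (angle ξ ^ (-(a + b + c))) with hm
  have hM₂ : l2norm m < ∞ := l2norm_angle_lt_top habc
  have hwm : Measurable w :=
    ((continuous_angle_rpow _).comp (by fun_prop)).measurable.ennreal_ofReal
  have hmm : Measurable m := (continuous_angle_rpow _).measurable.ennreal_ofReal
  set κ : ℝ≥0∞ := ‖((2 * (Real.pi : ℂ)) ^ 2)⁻¹‖ₑ with hκ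
  set C : ℝ≥0∞ := κ * ENNReal.ofReal K * (3 * M₁ * (3 * l2norm m)) with hC
  have hCtop : C ≠ ∞ := by
    refine ENNReal.mul_ne_top (ENNReal.mul_ne_top enorm_ne_top ENNReal.ofReal_ne_top) ?_
    exact ENNReal.mul_ne_top (ENNReal.mul_ne_top (by simp) hM₁.ne)
      (ENNReal.mul_ne_top (by simp) hM₂.ne)
  refine ⟨C.toReal, ENNReal.toReal_nonneg, fun u v => ?_⟩
  -- the weighted transforms in the coordinates `(τ, ξ)`
  have hmeas : ∀ (r ρ : ℝ) (f : 𝓢(Spacetime, ℂ)), Measurable fun q =>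
      ENNReal.ofReal (waveWeight r ρ q) * ‖stFourier f q‖ₑ := fun r ρ f =>
    (measurable_ofReal_waveWeight r ρ).mul (continuous_stFourier f).measurable.enorm
  set P : ℝ → ℝ → 𝓢(Spacetime, ℂ) → ℝ × ℝ → ℝ≥0∞ := fun r ρ f p =>
    ENNReal.ofReal (waveWeight r ρ (ofPlane p)) * ‖stFourier f (ofPlane p)‖ₑ with hP
  have hPm : ∀ r ρ f, Measurable (P r ρ f) := fun r ρ f =>
    (hmeas r ρ f).comp measurePreserving_ofPlane.measurable
  have hPn : ∀ r ρ f, l2norm (P r ρ f) = ENNReal.ofReal ‖toPreH r ρ f‖ := fun r ρ f => by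
    rw [ofReal_norm_toPreH, ← l2norm_comp_ofPlane (hmeas r ρ f)]
  set J := P (-c) (-γ) (schwartzMul u v) with hJ
  set F := P a α u with hF
  set G := P b β v with hG
  have hconv : ∀ q : ℝ × ℝ, ‖stFourier (schwartzMul u v) (ofPlane q)‖ₑ ≤
      κ * ∫⁻ p : ℝ × ℝ, ‖stFourier u (ofPlane p)‖ₑ * ‖stFourier v (ofPlane (q - p))‖ₑ := by
    intro q
    rw [stFourier_schwartzMul, enorm_mul]
    gcongr
    refine (enorm_integral_le_lintegral_enorm
      (fun p => stFourier u p * stFourier v (ofPlane q - p))).trans_eq ?_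
    simp only [ofPlane_sub]
    have h1 := (continuous_stFourier u).measurable
    have h2 := (continuous_stFourier v).measurable
    rw [← measurePreserving_ofPlane.lintegral_comp (by fun_prop)]
    simp only [enorm_mul]
  have hmult : ∀ p q : ℝ × ℝ, ENNReal.ofReal (waveWeight (-c) (-γ) (ofPlane q)) *
      (‖stFourier u (ofPlane p)‖ₑ * ‖stFourier v (ofPlane (q - p))‖ₑ) ≤
      ENNReal.ofReal K * (F p * G (q - p) *
        ((w p + w (q - p) + w q) * (m p.2 + m (q.2 - p.2) + m q.2))) := by
    intro p q
    have h := hpt p.2 (q - p).2 q.2 (|p.1| - |p.2|) (|(q - p).1| - |(q - p).2|) (|q.1| - |q.2|)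
      (by simp)
    have h' := ENNReal.ofReal_le_ofReal h
    have np : ∀ s r : ℝ, 0 ≤ angle s ^ r := fun s r => Real.rpow_nonneg (angle_pos s).le r
    have n3 : ∀ r s₁ s₂ s₃ : ℝ, ENNReal.ofReal (angle s₁ ^ r + angle s₂ ^ r + angle s₃ ^ r) =
        ENNReal.ofReal (angle s₁ ^ r) + ENNReal.ofReal (angle s₂ ^ r) +
          ENNReal.ofReal (angle s₃ ^ r) := fun r s₁ s₂ s₃ => by
      rw [ENNReal.ofReal_add (add_nonneg (np _ _) (np _ _)) (np _ _),
        ENNReal.ofReal_add (np _ _) (np _ _)]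
    rw [ENNReal.ofReal_mul (mul_nonneg (mul_nonneg hK.le (mul_nonneg (np _ _) (np _ _)))
        (mul_nonneg (np _ _) (np _ _))),
      ENNReal.ofReal_mul (mul_nonneg hK.le (mul_nonneg (np _ _) (np _ _))),
      ENNReal.ofReal_mul hK.le,
      ENNReal.ofReal_mul (add_nonneg (add_nonneg (np _ _) (np _ _)) (np _ _)), n3, n3] at h'
    calc _ ≤ _ := mul_le_mul_left h' _
      _ = _ := by
        simp only [hF, hG, hP, hw, hm, Prod.snd_sub]
        change _ * ENNReal.ofReal (waveWeight a α (ofPlane p)) *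
          ENNReal.ofReal (waveWeight b β (ofPlane (q - p))) * _ * _ = _
        ring
  have hFm : Measurable F := hPm _ _ _
  have hGm : Measurable G := hPm _ _ _
  have hJm : Measurable J := hPm _ _ _
  have main : l2norm J ≤ C * l2norm F * l2norm G := by
    refine l2norm_le_of_lintegral_le (by rw [hJ, hPn]; exact ENNReal.ofReal_ne_top) ?_
    calc ∫⁻ q, J q * J q
        ≤ ∫⁻ q, κ * ENNReal.ofReal K * ∫⁻ p, F p * G (q - p) * J q *
          ((w p + w (q - p) + w q) * (m p.2 + m (q.2 - p.2) + m q.2)) := by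
          refine lintegral_mono fun q => ?_
          have mu : Measurable fun p => ‖stFourier u (ofPlane p)‖ₑ :=
            ((continuous_stFourier u).measurable.comp
              measurePreserving_ofPlane.measurable).enorm
          have mv : Measurable fun p => ‖stFourier v (ofPlane (q - p))‖ₑ :=
            ((continuous_stFourier v).measurable.comp
              (measurePreserving_ofPlane.measurable.comp (by fun_prop))).enorm
          calc J q * J q ≤ ENNReal.ofReal (waveWeight (-c) (-γ) (ofPlane q)) *
                (κ * ∫⁻ p : ℝ × ℝ, ‖stFourier u (ofPlane p)‖ₑ *
                  ‖stFourier v (ofPlane (q - p))‖ₑ) * J q := by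
                gcongr
                exact mul_le_mul_right (hconv q) _
            _ = κ * J q * ∫⁻ p : ℝ × ℝ, ENNReal.ofReal (waveWeight (-c) (-γ) (ofPlane q)) *
                (‖stFourier u (ofPlane p)‖ₑ * ‖stFourier v (ofPlane (q - p))‖ₑ) := by
                rw [lintegral_const_mul _ (by fun_prop)]; ring
            _ ≤ κ * J q * ∫⁻ p : ℝ × ℝ, ENNReal.ofReal K * (F p * G (q - p) *
                ((w p + w (q - p) + w q) * (m p.2 + m (q.2 - p.2) + m q.2))) := by
                exact mul_le_mul_right (lintegral_mono fun p => hmult p q) _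
            _ = κ * ENNReal.ofReal K * (J q * ∫⁻ p : ℝ × ℝ, (F p * G (q - p) *
                ((w p + w (q - p) + w q) * (m p.2 + m (q.2 - p.2) + m q.2)))) := by
                rw [lintegral_const_mul _ (by fun_prop)]; ring
            _ = _ := by
                rw [← lintegral_const_mul _ (by fun_prop)]
                congr 1
                refine lintegral_congr fun p => ?_
                ring
      _ = κ * ENNReal.ofReal K * ∫⁻ q, ∫⁻ p, F p * G (q - p) * J q *
          ((w p + w (q - p) + w q) * (m p.2 + m (q.2 - p.2) + m q.2)) :=
          lintegral_const_mul _ (Measurable.lintegral_prod_right (by fun_prop))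
      _ ≤ κ * ENNReal.ofReal K * (3 * M₁ * (3 * l2norm m) *
            (l2norm F * l2norm G * l2norm J)) := by
          gcongr
          exact trilinear_plane_le hFm hGm hJm hwm hmm hM₁' le_rfl
      _ = C * l2norm F * l2norm G * l2norm J := by rw [hC]; ring
  rw [hJ, hF, hG, hPn, hPn, hPn, ← ENNReal.ofReal_toReal hCtop,
    ← ENNReal.ofReal_mul ENNReal.toReal_nonneg,
    ← ENNReal.ofReal_mul (mul_nonneg ENNReal.toReal_nonneg (norm_nonneg _))] at main
  exact (ENNReal.ofReal_le_ofReal_iff (by positivity)).1 main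

/-- A product estimate on Schwartz functions extends to the completions, one factor at a time. -/
lemma productEmbeds_of_norm_le {a₁ α₁ a₂ α₂ a₃ α₃ C : ℝ}
    (h : ∀ u v : 𝓢(Spacetime, ℂ),
      ‖toPreH a₃ α₃ (schwartzMul u v)‖ ≤ C * ‖toPreH a₁ α₁ u‖ * ‖toPreH a₂ α₂ v‖) :
    ProductEmbeds a₁ α₁ a₂ α₂ a₃ α₃ := by
  let B₀ : PreH a₁ α₁ →ₗ[ℂ] PreH a₂ α₂ →ₗ[ℂ] H a₃ α₃ :=
    LinearMap.mk₂ ℂ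
      (fun u v => ofSchwartz a₃ α₃
        (schwartzMul ((toPreH a₁ α₁).symm u) ((toPreH a₂ α₂).symm v)))
      (fun u u' v => by
        simp only [ofSchwartz, schwartzMul, map_add,
          add_apply, UniformSpace.Completion.coe_add])
      (fun k u v => by
        simp only [ofSchwartz, schwartzMul, map_smul,
          smul_apply, UniformSpace.Completion.coe_smul])
      (fun u v v' => by
        simp only [ofSchwartz, schwartzMul, map_add, UniformSpace.Completion.coe_add])
      (fun k u v => by
        simp only [ofSchwartz, schwartzMul, map_smul, UniformSpace.Completion.coe_smul])
  let B : PreH a₁ α₁ →L[ℂ] PreH a₂ α₂ →L[ℂ] H a₃ α₃ :=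
    B₀.mkContinuous₂ C fun u v => by
      change ‖((toPreH a₃ α₃ _ : PreH a₃ α₃) : H a₃ α₃)‖ ≤ _
      rw [UniformSpace.Completion.norm_coe]
      exact h ((toPreH a₁ α₁).symm u) ((toPreH a₂ α₂).symm v)
  let ι : ∀ r ρ : ℝ, PreH r ρ →L[ℂ] H r ρ := fun _ _ => UniformSpace.Completion.toComplL
  have hd : ∀ r ρ : ℝ, DenseRange (ι r ρ) := fun _ _ =>
    UniformSpace.Completion.denseRange_coe
  have hu : ∀ r ρ : ℝ, IsUniformInducing (ι r ρ) := fun r ρ =>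
    UniformSpace.Completion.isUniformInducing_coe (PreH r ρ)
  let B₁ : H a₁ α₁ →L[ℂ] PreH a₂ α₂ →L[ℂ] H a₃ α₃ := B.extend (ι a₁ α₁)
  let B₂ : H a₁ α₁ →L[ℂ] H a₂ α₂ →L[ℂ] H a₃ α₃ :=
    (B₁.flip.extend (ι a₂ α₂)).flip
  refine ⟨{ toFun := fun u => (B₂ u).toLinearMap
            map_add' := fun u v => by rw [map_add]; rfl
            map_smul' := fun k u => by rw [map_smul]; rfl }, fun u v => ?_,
    ‖B₂‖ + 1, by positivity, fun u v => ?_⟩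
  · change (B₁.flip.extend (ι a₂ α₂))
      (ι a₂ α₂ (toPreH a₂ α₂ v)) (ofSchwartz a₁ α₁ u) = _
    rw [ContinuousLinearMap.extend_eq _ (hd _ _) (hu _ _), ContinuousLinearMap.flip_apply]
    change (B.extend (ι a₁ α₁))
      (ι a₁ α₁ (toPreH a₁ α₁ u)) (toPreH a₂ α₂ v) = _
    rw [ContinuousLinearMap.extend_eq _ (hd _ _) (hu _ _)]
    rfl
  · change ‖B₂ u v‖ ≤ _
    refine (B₂.le_opNorm₂ u v).trans ?_
    gcongr
    linarith

lemma ProductEmbeds.exists_norm_le {a₁ α₁ a₂ α₂ a₃ α₃ : ℝ}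
    (h : ProductEmbeds a₁ α₁ a₂ α₂ a₃ α₃) : ∃ C : ℝ, 0 < C ∧ ∀ u v : 𝓢(Spacetime, ℂ),
      ‖toPreH a₃ α₃ (schwartzMul u v)‖ ≤ C * ‖toPreH a₁ α₁ u‖ * ‖toPreH a₂ α₂ v‖ := by
  obtain ⟨mul, hmul, C, hC, hb⟩ := h
  refine ⟨C, hC, fun u v => ?_⟩
  have := hb (ofSchwartz a₁ α₁ u) (ofSchwartz a₂ α₂ v)
  rw [hmul] at this
  simpa only [ofSchwartz, UniformSpace.Completion.norm_coe] using this

/-! ### Necessity: wave packets along the characteristic `τ = ξ` -/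

/-- The linear change of variables `(τ, ξ) ↦ (τ - ξ, ξ / L)`, straightening the line `τ = ξ`
and rescaling along it. -/
def shear (L : ℝ) (hL : L ≠ 0) : Spacetime ≃L[ℝ] Spacetime :=
  LinearEquiv.toContinuousLinearEquiv
    { toFun := fun q => !₂[q 0 - q 1, q 1 / L]
      invFun := fun p => !₂[p 0 + L * p 1, L * p 1]
      map_add' := fun p q => by
        ext i; fin_cases i <;> simp <;> ring
      map_smul' := fun r p => by
        ext i; fin_cases i <;> simp <;> ring
      left_inv := fun p => by
        ext i; fin_cases i <;> simp <;> field_simp; ring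
      right_inv := fun p => by
        ext i; fin_cases i <;> simp
        field_simp }

lemma shear_apply_zero (L : ℝ) (hL : L ≠ 0) (q : Spacetime) : shear L hL q 0 = q 0 - q 1 := rfl

lemma shear_apply_one (L : ℝ) (hL : L ≠ 0) (q : Spacetime) : shear L hL q 1 = q 1 / L := rfl

lemma det_shear (L : ℝ) (hL : L ≠ 0) :
    LinearMap.det ((shear L hL : Spacetime →L[ℝ] Spacetime) : Spacetime →ₗ[ℝ] Spacetime) =
      L⁻¹ := by
  rw [← LinearMap.det_toMatrix (EuclideanSpace.basisFun (Fin 2) ℝ).toBasis, Matrix.det_fin_two]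
  simp [LinearMap.toMatrix_apply, shear_apply_zero, shear_apply_one]

/-- The affine chart `q ↦ (τ - ξ, ξ / L - k)` centred at frequency `ξ = L k` on the line
`τ = ξ`. -/
def packetChart (L : ℝ) (hL : L ≠ 0) (k : ℝ) (q : Spacetime) : Spacetime :=
  shear L hL q - !₂[0, k]

lemma packetChart_sub (L : ℝ) (hL : L ≠ 0) (k₁ k₂ : ℝ) (p q : Spacetime) :
    packetChart L hL k₂ (q - p) = packetChart L hL (k₁ + k₂) q - packetChart L hL k₁ p := by
  unfold packetChart
  rw [map_sub]
  ext i; fin_cases i <;> simp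
  ring

lemma measurableEmbedding_packetChart (L : ℝ) (hL : L ≠ 0) (k : ℝ) :
    MeasurableEmbedding (packetChart L hL k) :=
  ((shear L hL).toHomeomorph.trans (Homeomorph.subRight !₂[0, k])).measurableEmbedding

lemma map_packetChart {L : ℝ} (hL : 0 < L) (k : ℝ) :
    Measure.map (packetChart L hL.ne' k) volume = ENNReal.ofReal L • volume := by
  have h := Measure.map_linearMap_addHaar_eq_smul_addHaar (volume : Measure Spacetime)
    (f := ((shear L hL.ne' : Spacetime →L[ℝ] Spacetime) : Spacetime →ₗ[ℝ] Spacetime))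
    (by rw [det_shear]; exact inv_ne_zero hL.ne')
  rw [det_shear, inv_inv, abs_of_pos hL] at h
  change Measure.map (shear L hL.ne') volume = _ at h
  have e : packetChart L hL.ne' k = (fun p => p - !₂[0, k]) ∘ shear L hL.ne' := rfl
  rw [e, ← Measure.map_map (by fun_prop) (shear L hL.ne').continuous.measurable, h,
    Measure.map_smul, (measurePreserving_sub_right volume _).map_eq]

lemma lintegral_comp_packetChart {L : ℝ} (hL : 0 < L) (k : ℝ) (g : Spacetime → ℝ≥0∞) :
    ∫⁻ q, g (packetChart L hL.ne' k q) = ENNReal.ofReal L * ∫⁻ p, g p := by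
  rw [← (measurableEmbedding_packetChart L hL.ne' k).lintegral_map, map_packetChart hL,
    lintegral_smul_measure, smul_eq_mul]

lemma integral_comp_packetChart {L : ℝ} (hL : 0 < L) (k : ℝ) (g : Spacetime → ℂ) :
    ∫ q, g (packetChart L hL.ne' k q) = L * ∫ p, g p := by
  rw [← (measurableEmbedding_packetChart L hL.ne' k).integral_map, map_packetChart hL,
    integral_smul_measure, ENNReal.toReal_ofReal hL.le, Complex.real_smul]

lemma l2norm_comp_packetChart {L : ℝ} (hL : 0 < L) (k : ℝ) (g : Spacetime → ℝ≥0∞) :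
    l2norm (fun q => g (packetChart L hL.ne' k q)) =
      ENNReal.ofReal (Real.sqrt L) * l2norm g := by
  rw [l2norm, lintegral_comp_packetChart hL k fun p => g p ^ (2 : ℝ),
    ENNReal.mul_rpow_of_nonneg _ _ (by norm_num), ENNReal.ofReal_rpow_of_nonneg hL.le (by norm_num),
    ← Real.sqrt_eq_rpow, l2norm]

/-- Where a packet chart stays in a ball the modulation is bounded, so that up to constants the
weights depend on the frequency `ξ` only. -/
lemma angle_modulation_le {L : ℝ} (hL : 0 < L) (k : ℝ) {q : Spacetime} {R : ℝ}
    (hq : ‖packetChart L hL.ne' k q‖ ≤ R) : angle (|q 0| - |q 1|) ≤ 1 + R := by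
  have h : |q 0 - q 1| ≤ R := by
    have := (PiLp.norm_apply_le (packetChart L hL.ne' k q) 0).trans hq
    simpa [packetChart, shear_apply_zero] using this
  unfold angle
  linarith [abs_abs_sub_abs_le_abs_sub (q 0) (q 1)]

lemma exists_packet_frequency {L : ℝ} (hL : 0 < L) (k : ℝ) {q : Spacetime} {R : ℝ}
    (hq : ‖packetChart L hL.ne' k q‖ ≤ R) : ∃ y : ℝ, |y| ≤ R ∧ q 1 = L * (k + y) := by
  refine ⟨packetChart L hL.ne' k q 1, (PiLp.norm_apply_le _ 1).trans hq, ?_⟩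
  simp only [packetChart, PiLp.sub_apply, shear_apply_one]
  have := hL.ne'
  simp
  field_simp

/-- The function with Fourier transform `Φ` in the packet chart. -/
lemma exists_packet (Φ : 𝓢(Spacetime, ℂ)) {R : ℝ} (hΦ : ∀ p, R < ‖p‖ → Φ p = 0) (L : ℝ)
    (hL : L ≠ 0) (k : ℝ) :
    ∃ u : 𝓢(Spacetime, ℂ), ∀ q, stFourier u q = Φ (packetChart L hL k q) := by
  have hc : HasCompactSupport fun q => Φ (packetChart L hL k q) := by
    have h : HasCompactSupport Φ := HasCompactSupport.intro (isCompact_closedBall 0 R) fun p hp =>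
      hΦ p (by simpa using hp)
    exact h.comp_homeomorph ((shear L hL).toHomeomorph.trans (Homeomorph.subRight !₂[0, k]))
  have hs : ContDiff ℝ ((⊤ : ℕ∞) : WithTop ℕ∞) fun q => Φ (packetChart L hL k q) := by
    refine Φ.smooth'.comp ?_
    unfold packetChart
    exact (shear L hL).contDiff.sub contDiff_const
  exact exists_stFourier_eq (hc.toSchwartzMap hs)

lemma norm_packet_le {a α L k B R : ℝ} (hα : 0 ≤ α) (hL : 0 < L) (hR : 0 ≤ R)
    (hB : ∀ y, |y| ≤ R → angle (L * (k + y)) ^ a ≤ B) {Φ : Spacetime → ℂ}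
    (hΦ : ∀ p, R < ‖p‖ → Φ p = 0) (hfin : l2norm (fun p => ‖Φ p‖ₑ) ≠ ∞) {u : 𝓢(Spacetime, ℂ)}
    (hu : ∀ q, stFourier u q = Φ (packetChart L hL.ne' k q)) :
    ‖toPreH a α u‖ ≤
      B * (1 + R) ^ α * (Real.sqrt L * (l2norm fun p => ‖Φ p‖ₑ).toReal) := by
  have hB0 : 0 ≤ B := (Real.rpow_nonneg (angle_pos _).le _).trans (hB 0 (by simpa using hR))
  have h : ENNReal.ofReal ‖toPreH a α u‖ ≤ ENNReal.ofReal (B * (1 + R) ^ α) *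
      (ENNReal.ofReal (Real.sqrt L) * l2norm fun p => ‖Φ p‖ₑ) := by
    rw [ofReal_norm_toPreH, ← l2norm_comp_packetChart hL k,
      const_mul_l2norm ENNReal.ofReal_ne_top]
    refine l2norm_mono fun q => ?_
    rw [hu]
    rcases lt_or_ge R ‖packetChart L hL.ne' k q‖ with hq | hq
    · rw [hΦ _ hq]; simp
    · gcongr
      obtain ⟨y, hy, hqy⟩ := exists_packet_frequency hL k hq
      unfold waveWeight
      have h1 := hB y hy
      rw [← hqy] at h1
      exact mul_le_mul h1 (Real.rpow_le_rpow (angle_pos _).le (angle_modulation_le hL k hq) hα)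
        (Real.rpow_nonneg (angle_pos _).le _) hB0
  rw [← ENNReal.ofReal_toReal hfin, ← ENNReal.ofReal_mul (by positivity),
    ← ENNReal.ofReal_mul (by positivity)] at h
  exact (ENNReal.ofReal_le_ofReal_iff (by positivity)).1 h

lemma le_norm_packet {a α L k B R : ℝ} (hα : 0 ≤ α) (hL : 0 < L) (hR : 0 ≤ R) (hB0 : 0 ≤ B)
    (hB : ∀ y, |y| ≤ R → B ≤ angle (L * (k + y)) ^ a) {Φ : Spacetime → ℂ}
    (hΦ : ∀ p, R < ‖p‖ → Φ p = 0) (hfin : l2norm (fun p => ‖Φ p‖ₑ) ≠ ∞) {u : 𝓢(Spacetime, ℂ)}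
    (hu : ∀ q, stFourier u q = Φ (packetChart L hL.ne' k q)) :
    B * (1 + R) ^ (-α) * (Real.sqrt L * (l2norm fun p => ‖Φ p‖ₑ).toReal) ≤
      ‖toPreH a (-α) u‖ := by
  have h : ENNReal.ofReal (B * (1 + R) ^ (-α)) *
      (ENNReal.ofReal (Real.sqrt L) * l2norm fun p => ‖Φ p‖ₑ) ≤
        ENNReal.ofReal ‖toPreH a (-α) u‖ := by
    rw [ofReal_norm_toPreH, ← l2norm_comp_packetChart hL k,
      const_mul_l2norm ENNReal.ofReal_ne_top]
    refine l2norm_mono fun q => ?_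
    rw [hu]
    rcases lt_or_ge R ‖packetChart L hL.ne' k q‖ with hq | hq
    · rw [hΦ _ hq]; simp
    · gcongr
      obtain ⟨y, hy, hqy⟩ := exists_packet_frequency hL k hq
      unfold waveWeight
      have h1 := hB y hy
      rw [← hqy] at h1
      exact mul_le_mul h1 (Real.rpow_le_rpow_of_nonpos (angle_pos _) (angle_modulation_le hL k hq)
        (by linarith)) (by positivity) (hB0.trans h1)
  rw [← ENNReal.ofReal_toReal hfin, ← ENNReal.ofReal_mul (by positivity),
    ← ENNReal.ofReal_mul (by positivity)] at h
  exact (ENNReal.ofReal_le_ofReal_iff (by positivity)).1 h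

/-- The product of two packets with the same scale `L` is again one: the convolution of the profiles picks up
the Jacobian `L`. -/
lemma stFourier_mul_packet {u v u₁ v₁ : 𝓢(Spacetime, ℂ)} {L k₁ k₂ : ℝ} (hL : 0 < L)
    (hu : ∀ q, stFourier u₁ q = stFourier u (packetChart L hL.ne' k₁ q))
    (hv : ∀ q, stFourier v₁ q = stFourier v (packetChart L hL.ne' k₂ q)) (q : Spacetime) :
    stFourier (schwartzMul u₁ v₁) q =
      L * stFourier (schwartzMul u v) (packetChart L hL.ne' (k₁ + k₂) q) := by
  rw [stFourier_schwartzMul, stFourier_schwartzMul]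
  simp only [hu, hv, packetChart_sub L hL.ne' k₁ k₂]
  rw [integral_comp_packetChart hL k₁ fun p =>
    stFourier u p * stFourier v (packetChart L hL.ne' (k₁ + k₂) q - p)]
  ring

/-- A nonzero function with Fourier support in the ball of radius `2`. -/
lemma exists_compact_fourier_support :
    ∃ u : 𝓢(Spacetime, ℂ), u ≠ 0 ∧ ∀ p, 2 < ‖p‖ → stFourier u p = 0 := by
  let φ : ContDiffBump (0 : Spacetime) := ⟨1, 2, one_pos, one_lt_two⟩
  have hs : ContDiff ℝ ((⊤ : ℕ∞) : WithTop ℕ∞) fun p => (φ p : ℂ) :=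
    Complex.ofRealCLM.contDiff.comp φ.contDiff
  have h0 : ∀ p : Spacetime, 2 ≤ ‖p‖ → φ p = 0 := fun p hp =>
    φ.zero_of_le_dist (by simpa using hp)
  have hc : HasCompactSupport fun p => (φ p : ℂ) :=
    φ.hasCompactSupport.comp_left (g := fun x : ℝ => (x : ℂ)) Complex.ofReal_zero
  obtain ⟨u, hu⟩ := exists_stFourier_eq (hc.toSchwartzMap hs)
  have hu' : ∀ q, stFourier u q = (φ q : ℂ) := hu
  refine ⟨u, ?_, fun p hp => by rw [hu', h0 p hp.le, Complex.ofReal_zero]⟩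
  rintro rfl
  have h1 := hu' 0
  rw [φ.one_of_mem_closedBall (by simp [φ]), stFourier] at h1
  simp at h1

lemma stFourier_mul_eq_zero {u v : 𝓢(Spacetime, ℂ)} {R S : ℝ}
    (hu : ∀ p, R < ‖p‖ → stFourier u p = 0) (hv : ∀ p, S < ‖p‖ → stFourier v p = 0)
    (q : Spacetime) (hq : R + S < ‖q‖) : stFourier (schwartzMul u v) q = 0 := by
  rw [stFourier_schwartzMul, integral_eq_zero_of_ae, mul_zero]
  refine Filter.Eventually.of_forall fun p => ?_
  rcases lt_or_ge R ‖p‖ with hp | hp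
  · simp [hu p hp]
  · have : S < ‖q - p‖ := by linarith [norm_sub_norm_le q p]
    simp [hv _ this]

/-- The `L²` norm of the transform is the norm of `H^{0,0}`. -/
lemma l2norm_stFourier (u : 𝓢(Spacetime, ℂ)) :
    l2norm (fun p => ‖stFourier u p‖ₑ) = ENNReal.ofReal ‖toPreH 0 0 u‖ := by
  rw [ofReal_norm_toPreH]
  simp [waveWeight]

lemma rpow_le_of_comparable {x K D : ℝ} (hx : 0 < x) (hK : 0 < K) (hD : 1 ≤ D)
    (h₁ : x ≤ D * K) (h₂ : K ≤ D * x) (r : ℝ) : x ^ r ≤ D ^ |r| * K ^ r := by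
  have hD0 : 0 < D := by linarith
  rcases le_total 0 r with hr | hr
  · rw [abs_of_nonneg hr, ← Real.mul_rpow hD0.le hK.le]
    exact Real.rpow_le_rpow hx.le h₁ hr
  · rw [abs_of_nonpos hr, Real.rpow_neg hD0.le, ← Real.inv_rpow hD0.le,
      ← Real.mul_rpow (by positivity) hK.le]
    refine Real.rpow_le_rpow_of_nonpos (by positivity) ?_ hr
    rw [inv_mul_le_iff₀ hD0]
    exact h₂

/-- Testing a product estimate on wave packets of length `L` at the frequencies `L k₁`, `L k₂`,
whose product lives at `L (k₁ + k₂)`; `K₁`, `K₂`, `K₀` are the sizes of these frequencies. -/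
lemma exists_sqrt_le_of_product_estimate {a b c α β γ C : ℝ} (hα : 0 ≤ α) (hβ : 0 ≤ β)
    (hγ : 0 ≤ γ) (hC : 0 < C)
    (h : ∀ u v : 𝓢(Spacetime, ℂ),
      ‖toPreH (-c) (-γ) (schwartzMul u v)‖ ≤ C * ‖toPreH a α u‖ * ‖toPreH b β v‖)
    {D : ℝ} (hD : 1 ≤ D) : ∃ C' : ℝ, ∀ L k₁ k₂ K₁ K₂ K₀ : ℝ, 0 < L → 0 < K₁ → 0 < K₂ → 0 < K₀ →
      (∀ y, |y| ≤ 4 → angle (L * (k₁ + y)) ≤ D * K₁ ∧ K₁ ≤ D * angle (L * (k₁ + y))) →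
      (∀ y, |y| ≤ 4 → angle (L * (k₂ + y)) ≤ D * K₂ ∧ K₂ ≤ D * angle (L * (k₂ + y))) →
      (∀ y, |y| ≤ 4 → angle (L * (k₁ + k₂ + y)) ≤ D * K₀ ∧
        K₀ ≤ D * angle (L * (k₁ + k₂ + y))) →
      Real.sqrt L ≤ C' * (K₁ ^ a * K₂ ^ b * K₀ ^ c) := by
  have hD0 : 0 < D := by linarith
  obtain ⟨u, hu0, hu⟩ := exists_compact_fourier_support
  set w := schwartzMul u u with hw
  have hw0 : w ≠ 0 := by
    intro hw0
    apply hu0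
    ext p
    have := schwartzMul_apply u u p
    rw [← hw, hw0] at this
    simpa using this.symm
  set P := ‖toPreH 0 0 u‖
  set Q := ‖toPreH 0 0 w‖ with hQ
  have hQ0 : 0 < Q := by
    rw [hQ, norm_pos_iff]
    exact (LinearEquiv.map_ne_zero_iff _).2 hw0
  have hPn : (l2norm fun p => ‖stFourier u p‖ₑ).toReal = P := by
    rw [l2norm_stFourier, ENNReal.toReal_ofReal (norm_nonneg _)]
  have hwsupp : ∀ p, 4 < ‖p‖ → stFourier w p = 0 := fun p hp =>
    stFourier_mul_eq_zero hu hu p (by linarith)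
  have husupp : ∀ p, 4 < ‖p‖ → stFourier u p = 0 := fun p hp => hu p (by linarith)
  refine ⟨C * D ^ |a| * D ^ |b| * D ^ |c| * (1 + 4) ^ α * (1 + 4) ^ β * (1 + 4) ^ γ * P ^ 2 / Q,
    fun L k₁ k₂ K₁ K₂ K₀ hL hK₁ hK₂ hK₀ h₁ h₂ h₀ => ?_⟩
  obtain ⟨u₁, hu₁⟩ := exists_packet (stFourierSchwartz u) (R := 2)
    (fun p hp => by rw [stFourierSchwartz_apply, hu p hp]) L hL.ne' k₁
  obtain ⟨u₂, hu₂⟩ := exists_packet (stFourierSchwartz u) (R := 2)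
    (fun p hp => by rw [stFourierSchwartz_apply, hu p hp]) L hL.ne' k₂
  simp only [stFourierSchwartz_apply] at hu₁ hu₂
  have hfin : l2norm (fun p => ‖stFourier u p‖ₑ) ≠ ∞ := by
    rw [l2norm_stFourier]; exact ENNReal.ofReal_ne_top
  have n₁ := norm_packet_le (a := a) hα hL (by norm_num : (0 : ℝ) ≤ 4)
    (fun y hy => rpow_le_of_comparable (angle_pos _) hK₁ hD (h₁ y hy).1 (h₁ y hy).2 a)
    husupp hfin hu₁
  have n₂ := norm_packet_le (a := b) hβ hL (by norm_num : (0 : ℝ) ≤ 4)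
    (fun y hy => rpow_le_of_comparable (angle_pos _) hK₂ hD (h₂ y hy).1 (h₂ y hy).2 b)
    husupp hfin hu₂
  -- the profile of the product, with the Jacobian included
  have hl : l2norm (fun p => ‖(L : ℂ) * stFourier w p‖ₑ) = ENNReal.ofReal (L * Q) := by
    have : ∀ p, (L : ℂ) * stFourier w p = stFourier ((L : ℂ) • w : 𝓢(Spacetime, ℂ)) p :=
      fun p => by
        rw [← stFourierSchwartz_apply, ← stFourierSchwartz_apply]
        simp [stFourierSchwartz, FourierTransform.fourier_smul]
    simp only [this]
    rw [l2norm_stFourier, map_smul, norm_smul, Complex.norm_real, Real.norm_of_nonneg hL.le]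
  have n₀ := le_norm_packet (a := -c) (B := D ^ (-|c|) * K₀ ^ (-c)) hγ hL
    (by norm_num : (0 : ℝ) ≤ 4) (by positivity)
    (fun y hy => by
      have := rpow_le_of_comparable hK₀ (angle_pos (L * (k₁ + k₂ + y))) hD (h₀ y hy).2
        (h₀ y hy).1 (-c)
      rw [abs_neg] at this
      rwa [Real.rpow_neg hD0.le, inv_mul_le_iff₀ (by positivity)])
    (Φ := fun p => (L : ℂ) * stFourier w p) (fun p hp => by rw [hwsupp p hp, mul_zero])
    (by rw [hl]; exact ENNReal.ofReal_ne_top) (stFourier_mul_packet hL hu₁ hu₂)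
  rw [hl, ENNReal.toReal_ofReal (by positivity)] at n₀
  rw [hPn] at n₁ n₂
  have hP0 : 0 ≤ P := norm_nonneg _
  have key := n₀.trans ((h u₁ u₂).trans (mul_le_mul (mul_le_mul_of_nonneg_left n₁ hC.le) n₂
    (norm_nonneg _) (by positivity)))
  rw [Real.rpow_neg hD0.le, Real.rpow_neg hK₀.le, Real.rpow_neg (by norm_num)] at key
  have hs : Real.sqrt L * Real.sqrt L = L := Real.mul_self_sqrt hL.le
  rw [div_mul_eq_mul_div, le_div_iff₀ hQ0]
  set X := D ^ |c| * K₀ ^ c * (1 + 4) ^ γ with hX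
  have hX0 : 0 < X := by positivity
  have k2 : Real.sqrt L * Q * L ≤ (X * (C * D ^ |a| * D ^ |b| * (1 + 4) ^ α * (1 + 4) ^ β * P ^ 2 *
      (K₁ ^ a * K₂ ^ b))) * L := by
    calc Real.sqrt L * Q * L
        = X * ((D ^ |c|)⁻¹ * (K₀ ^ c)⁻¹ * ((1 + 4) ^ γ)⁻¹ * (Real.sqrt L * (L * Q))) := by
          rw [hX]
          have e1 : D ^ |c| ≠ 0 := (Real.rpow_pos_of_pos hD0 _).ne'
          have e2 : K₀ ^ c ≠ 0 := (Real.rpow_pos_of_pos hK₀ _).ne'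
          have e3 : ((1 : ℝ) + 4) ^ γ ≠ 0 := (Real.rpow_pos_of_pos (by norm_num) _).ne'
          field_simp
      _ ≤ X * _ := mul_le_mul_of_nonneg_left key hX0.le
      _ = X * (C * D ^ |a| * D ^ |b| * (1 + 4) ^ α * (1 + 4) ^ β * P ^ 2 *
            (K₁ ^ a * K₂ ^ b)) * (Real.sqrt L * Real.sqrt L) := by ring
      _ = _ := by rw [hs]
  refine (le_of_mul_le_mul_right k2 hL).trans_eq ?_
  rw [hX]; ring

/-- A power bounded by another one for all large arguments has the smaller exponent. -/
lemma exponent_le_of_rpow_le {C r s N₀ : ℝ} (h : ∀ N : ℝ, N₀ ≤ N → N ^ r ≤ C * N ^ s) :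
    r ≤ s := by
  by_contra! hlt
  have h1 := (tendsto_rpow_atTop (sub_pos.2 hlt)).eventually_gt_atTop C
  obtain ⟨N, hN, hN₀, hpos⟩ := (h1.and ((Filter.eventually_ge_atTop N₀).and
    (Filter.eventually_gt_atTop 0))).exists
  have h2 := h N hN₀
  rw [Real.rpow_sub hpos, lt_div_iff₀ (Real.rpow_pos_of_pos hpos s)] at hN
  linarith

lemma necessary_of_product_estimate {a b c α β γ C : ℝ} (hα : 0 ≤ α) (hβ : 0 ≤ β)
    (hγ : 0 ≤ γ) (hC : 0 < C)
    (h : ∀ u v : 𝓢(Spacetime, ℂ),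
      ‖toPreH (-c) (-γ) (schwartzMul u v)‖ ≤ C * ‖toPreH a α u‖ * ‖toPreH b β v‖) :
    1 / 2 ≤ a + b + c ∧ 0 ≤ a + b ∧ 0 ≤ a + c ∧ 0 ≤ b + c := by
  -- `25` serves all configurations, the largest frequency being `N * (16 + y) ≤ 20 * N`
  obtain ⟨C', h'⟩ := exists_sqrt_le_of_product_estimate hα hβ hγ hC h
    (by norm_num : (1 : ℝ) ≤ 25)
  -- unit packets at frequencies near `±N` and near `0`
  have far : ∀ N : ℝ, 1 ≤ N → ∀ k : ℝ, |k| = N → ∀ y : ℝ, |y| ≤ 4 →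
      angle (1 * (k + y)) ≤ 25 * N ∧ N ≤ 25 * angle (1 * (k + y)) := by
    intro N hN k hk y hy
    rw [one_mul, angle]
    have h1 := abs_add_le k y
    have h2 := abs_sub_abs_le_abs_sub k (-y)
    rw [abs_neg, sub_neg_eq_add] at h2
    constructor <;> linarith [abs_nonneg (k + y)]
  have near : ∀ k : ℝ, k = 0 → ∀ y : ℝ, |y| ≤ 4 →
      angle (1 * (k + y)) ≤ 25 * 1 ∧ 1 ≤ 25 * angle (1 * (k + y)) := by
    rintro k rfl y hy
    rw [one_mul, angle, zero_add]
    constructor <;> linarith [abs_nonneg y]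
  refine ⟨?_, ?_, ?_, ?_⟩
  · -- packets of length `N`; since `|y| ≤ 4`, the centres `k = 8` and `k = 8 + 8` keep the
    -- frequencies `N (k + y)` away from `0`
    refine exponent_le_of_rpow_le (C := C') (N₀ := 1) fun N hN => ?_
    have hN0 : 0 < N := by linarith
    have big : ∀ k : ℝ, 8 ≤ k → k ≤ 16 → ∀ y : ℝ, |y| ≤ 4 →
        angle (N * (k + y)) ≤ 25 * N ∧ N ≤ 25 * angle (N * (k + y)) := by
      intro k hk hk' y hy
      obtain ⟨hy1, hy2⟩ := abs_le.1 hy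
      rw [angle, abs_of_nonneg (mul_nonneg hN0.le (by linarith))]
      constructor <;> nlinarith
    have := h' N 8 8 N N N hN0 hN0 hN0 hN0 (big 8 le_rfl (by norm_num))
      (big 8 le_rfl (by norm_num)) (big (8 + 8) (by norm_num) (by norm_num))
    rwa [Real.sqrt_eq_rpow, ← Real.rpow_add hN0, ← Real.rpow_add hN0] at this
  · refine exponent_le_of_rpow_le (C := C') (N₀ := 1) fun N hN => ?_
    have hN0 : 0 < N := by linarith
    have := h' 1 N (-N) N N 1 one_pos hN0 hN0 one_pos (far N hN N (abs_of_pos hN0))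
      (far N hN (-N) (by rw [abs_neg, abs_of_pos hN0])) (near _ (by ring))
    rwa [Real.sqrt_one, Real.one_rpow, mul_one, ← Real.rpow_add hN0, ← Real.rpow_zero N] at this
  · refine exponent_le_of_rpow_le (C := C') (N₀ := 1) fun N hN => ?_
    have hN0 : 0 < N := by linarith
    have := h' 1 N 0 N 1 N one_pos hN0 one_pos hN0 (far N hN N (abs_of_pos hN0))
      (near _ rfl) (far N hN _ (by rw [add_zero, abs_of_pos hN0]))
    rwa [Real.sqrt_one, Real.one_rpow, mul_one, ← Real.rpow_add hN0, ← Real.rpow_zero N] at this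
  · refine exponent_le_of_rpow_le (C := C') (N₀ := 1) fun N hN => ?_
    have hN0 : 0 < N := by linarith
    have := h' 1 0 N 1 N N one_pos one_pos hN0 hN0 (near _ rfl)
      (far N hN N (abs_of_pos hN0)) (far N hN _ (by rw [zero_add, abs_of_pos hN0]))
    rwa [Real.sqrt_one, Real.one_rpow, one_mul, ← Real.rpow_add hN0, ← Real.rpow_zero N] at this

end

end WaveSobolev

theorem theorem2 (a b c α β γ : ℝ) (hα : 0 ≤ α) (hβ : 0 ≤ β) (hγ : 0 ≤ γ)
    (hαβγ : 1 / 2 < α + β + γ) :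
    ((1 / 2 < a + b + c ∧ 0 ≤ a + b ∧ 0 ≤ a + c ∧ 0 ≤ b + c) →
      WaveSobolev.ProductEmbeds a α b β (-c) (-γ)) ∧
    (WaveSobolev.ProductEmbeds a α b β (-c) (-γ) →
      1 / 2 ≤ a + b + c ∧ 0 ≤ a + b ∧ 0 ≤ a + c ∧ 0 ≤ b + c) := by
  refine ⟨fun ⟨habc, hab, hac, hbc⟩ => ?_, fun h => ?_⟩
  · obtain ⟨C, -, hC⟩ := WaveSobolev.exists_norm_schwartzMul_le hα hβ hγ hαβγ habc hab hac hbc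
    exact WaveSobolev.productEmbeds_of_norm_le hC
  · obtain ⟨C, hC, hb⟩ := h.exists_norm_le
    exact WaveSobolev.necessary_of_product_estimate hα hβ hγ hC hb
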